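/- Let $k,d\ge 1$ be integers, $\delta>0$, and let $Y_1,\dots,Y_k$ be i.i.d. random vectors in $\mathbb{R}^d$ with finite second moments, mean $\mu$ and covariance matrix $\Lambda$. For $x\in\mathbb{R}^d$, $r>0$ and $\mathbf{Z}=(Z_1,\dots,Z_k)$ with $Z_i\in\mathbb{R}^d$, let $MT(x,r,\mathbf{Z})$ denote the semidefinite program over real symmetric matrices $X\in\mathbb{R}^{(k+d+1)\times(k+d+1)}$, with rows and columns indexed by the symbols $1,b_1,\dots,b_k,v_1,\dots,v_d$, $$\max \sum_{i=1}^k X_{1,b_i}\quad\text{subject to}\quad X_{1,b_i}=X_{b_i,b_i}\ (1\le i\le k),\quad X_{1,1}=1,\quad \sum_{j=1}^d X_{v_j,v_j}=1,$$ $$\langle v_{b_i}, Z_i-x\rangle\ \ge\ X_{b_i,b_i}\,r\ (1\le i\le k),\quad X\succeq 0,\qquad\text{where } v_{b_i}:=(X_{b_i,v_1},\dots,X_{b_i,v_d}).$$ Suppose that $k\ge 3200\log(1/\delta)$, and let $r>0$ satisfy $r\ge 300\left(\sqrt{\operatorname{Tr}\Lambda/k}+\sqrt{\|\Lambda\|}\right)$,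 where $\|\Lambda\|$ is the spectral norm. Then, with probability at least $1-\delta$, every feasible solution $X$ of $MT(\mu,r,\mathbf{Y})$, where $\mathbf{Y}=(Y_1,\dots,Y_k)$, satisfies $$\sum_{i=1}^k X_{b_i,b_i}\le \frac{k}{20}.$$ -/

import Mathlib

open MeasureTheory ProbabilityTheory

/-- The symbolic index set `{1, b_1, …, b_k, v_1, …, v_d}` of the semidefinite relaxation. -/
abbrev MTIndex (k d : ℕ) : Type := Unit ⊕ (Fin k ⊕ Fin d)

namespace MTIndex

/-- The index `1`. -/
abbrev one {k d : ℕ} : MTIndex k d := Sum.inl ()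

/-- The index `b_i`. -/
abbrev b {k d : ℕ} (i : Fin k) : MTIndex k d := Sum.inr (Sum.inl i)

/-- The index `v_j`. -/
abbrev v {k d : ℕ} (j : Fin d) : MTIndex k d := Sum.inr (Sum.inr j)

end MTIndex

/-- The vector `v_{b_i} = (X_{b_i, v_1}, …, X_{b_i, v_d})` of `ℝ^d`. -/
def mtVec {k d : ℕ} (X : Matrix (MTIndex k d) (MTIndex k d) ℝ) (i : Fin k) :
    EuclideanSpace ℝ (Fin d) :=
  WithLp.toLp 2 (fun j => X (MTIndex.b i) (MTIndex.v j))

/-- `X` is a feasible solution of the semidefinite program `MT(x, r, Z)`. -/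
structure MTFeasible {k d : ℕ} (x : EuclideanSpace ℝ (Fin d)) (r : ℝ)
    (Z : Fin k → EuclideanSpace ℝ (Fin d))
    (X : Matrix (MTIndex k d) (MTIndex k d) ℝ) : Prop where
  one_b : ∀ i : Fin k, X MTIndex.one (MTIndex.b i) = X (MTIndex.b i) (MTIndex.b i)
  one_one : X MTIndex.one MTIndex.one = 1
  trace_v : ∑ j : Fin d, X (MTIndex.v j) (MTIndex.v j) = 1
  margin : ∀ i : Fin k, X (MTIndex.b i) (MTIndex.b i) * r ≤ inner ℝ (mtVec X i) (Z i - x)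
  posSemidef : X.PosSemidef

/-! Factor a feasible `X` as a Gram matrix. The `v`-columns give vectors `c a` in `ℝ^d` with `∑ ‖c
a‖² = 1`, and Cauchy–Schwarz bounds each `X_{b_i,b_i}` by `min 1 (q_i / r²)`, where `q_i = ∑ ⟨c a,
Y_i - μ⟩²` (`MTFeasible.sum_le_truncSup`). All objectives are thus at most one random variable,
`truncSup`, and it suffices to bound its upper tail.

Each summand of `truncSup` lies in `[0, 1]`, so McDiarmid's inequality concentrates it with no tail
assumption on the `Y_i`. For its mean, `min 1 t² ≤ t` replaces `q_i / r²` by `√q_i / r`.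
Khintchine's inequality, applied to random sign combinations of the `c a`, rounds the family to a
single vector at the cost of a factor 2 (`sum_sqrt_le_ballSup`). What remains is the expected
supremum of `∑ |⟨v, Y_i - μ⟩|` over the unit ball. Symmetrization and contraction bound it by `2 √(k
Tr Λ) + k √‖Λ‖` (`integral_ballSup_le`), which is at most `k r / 150`. So the mean is at most `k /
75`, and exceeding `k / 20` is a deviation of order `k`. -/

/-! ### Averages over signs and Khintchine's inequality. -/

/-- The average of `f s` over all sign vectors `s ∈ {1, -1}ⁿ`. -/
noncomputable def signAvg : (n : ℕ) → ((Fin n → ℝ) → ℝ) → ℝ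
  | 0, f => f Fin.elim0
  | n + 1, f => (signAvg n (fun s => f (Fin.cons 1 s)) + signAvg n (fun s => f (Fin.cons (-1) s))) / 2

/-- `s` is a vector of signs. -/
def IsSignVec {n : ℕ} (s : Fin n → ℝ) : Prop := ∀ i, s i = 1 ∨ s i = -1

theorem IsSignVec.cons {n : ℕ} {s : Fin n → ℝ} (hs : IsSignVec s) {a : ℝ} (ha : a = 1 ∨ a = -1) :
    IsSignVec (Fin.cons a s : Fin (n + 1) → ℝ) := fun i => by
  refine Fin.cases ?_ (fun i => ?_) i
  · simpa using ha
  · simpa using hs i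

theorem IsSignVec.abs {n : ℕ} {s : Fin n → ℝ} (hs : IsSignVec s) (i : Fin n) : |s i| = 1 := by
  rcases hs i with h | h <;> simp [h]

theorem signAvg_mono {n : ℕ} {f g : (Fin n → ℝ) → ℝ} (h : ∀ s, IsSignVec s → f s ≤ g s) :
    signAvg n f ≤ signAvg n g := by
  induction n with
  | zero => exact h _ (fun i => i.elim0)
  | succ n ih =>
    simp only [signAvg]
    have h1 := ih (f := fun s => f (Fin.cons 1 s)) (g := fun s => g (Fin.cons 1 s))
      (fun s hs => h _ (hs.cons (Or.inl rfl)))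
    have h2 := ih (f := fun s => f (Fin.cons (-1) s)) (g := fun s => g (Fin.cons (-1) s))
      (fun s hs => h _ (hs.cons (Or.inr rfl)))
    linarith

theorem signAvg_add {n : ℕ} (f g : (Fin n → ℝ) → ℝ) :
    signAvg n (fun s => f s + g s) = signAvg n f + signAvg n g := by
  induction n with
  | zero => rfl
  | succ n ih => simp only [signAvg, ih]; ring

theorem signAvg_const_mul {n : ℕ} (c : ℝ) (f : (Fin n → ℝ) → ℝ) :
    signAvg n (fun s => c * f s) = c * signAvg n f := by
  induction n with
  | zero => rfl
  | succ n ih => simp only [signAvg, ih]; ring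

theorem signAvg_const {n : ℕ} (c : ℝ) : signAvg n (fun _ => c) = c := by
  induction n with
  | zero => rfl
  | succ n ih => simp only [signAvg, ih]; ring

theorem signAvg_sum {n : ℕ} {ι : Type*} (t : Finset ι) (f : ι → (Fin n → ℝ) → ℝ) :
    signAvg n (fun s => ∑ i ∈ t, f i s) = ∑ i ∈ t, signAvg n (f i) := by
  induction n with
  | zero => rfl
  | succ n ih => simp only [signAvg, ih, ← Finset.sum_add_distrib, Finset.sum_div]

theorem integrable_signAvg {Ω : Type*} [MeasurableSpace Ω] {P : Measure Ω} {n : ℕ}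
    {f : Ω → (Fin n → ℝ) → ℝ} (h : ∀ s, IsSignVec s → Integrable (fun ω => f ω s) P) :
    Integrable (fun ω => signAvg n (f ω)) P := by
  induction n with
  | zero => exact h _ (fun i => i.elim0)
  | succ n ih =>
    simp only [signAvg]
    exact ((ih (f := fun ω s => f ω (Fin.cons 1 s)) fun s hs => h _ (hs.cons (Or.inl rfl))).add
      (ih (f := fun ω s => f ω (Fin.cons (-1) s)) fun s hs => h _ (hs.cons (Or.inr rfl)))).div_const 2

theorem integral_signAvg {Ω : Type*} [MeasurableSpace Ω] {P : Measure Ω} {n : ℕ}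
    {f : Ω → (Fin n → ℝ) → ℝ} (h : ∀ s, IsSignVec s → Integrable (fun ω => f ω s) P) :
    ∫ ω, signAvg n (f ω) ∂P = signAvg n (fun s => ∫ ω, f ω s ∂P) := by
  induction n with
  | zero => rfl
  | succ n ih =>
    simp only [signAvg]
    have h1 : ∀ s, IsSignVec s → Integrable (fun ω => f ω (Fin.cons 1 s)) P :=
      fun s hs => h _ (hs.cons (Or.inl rfl))
    have h2 : ∀ s, IsSignVec s → Integrable (fun ω => f ω (Fin.cons (-1) s)) P :=
      fun s hs => h _ (hs.cons (Or.inr rfl))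
    rw [integral_div, integral_add (integrable_signAvg h1) (integrable_signAvg h2),
      ih (f := fun ω s => f ω (Fin.cons 1 s)) h1, ih (f := fun ω s => f ω (Fin.cons (-1) s)) h2]

/-- The shift `c` makes the induction close: each new sign turns `c` into `c ± x 0`, and the
parallelogram law averages the two. -/
theorem signAvg_norm_sq {E : Type*} [NormedAddCommGroup E] [InnerProductSpace ℝ E] {n : ℕ}
    (c : E) (x : Fin n → E) :
    signAvg n (fun s => ‖c + ∑ i, s i • x i‖ ^ 2) = ‖c‖ ^ 2 + ∑ i, ‖x i‖ ^ 2 := by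
  induction n generalizing c with
  | zero => simp [signAvg]
  | succ n ih =>
    simp only [signAvg, Fin.sum_univ_succ, Fin.cons_zero, Fin.cons_succ, ← add_assoc, ih, one_smul,
      neg_smul, ← sub_eq_add_neg]
    have := parallelogram_law_with_norm ℝ c (x 0)
    linarith

theorem signAvg_sq {n : ℕ} (x : Fin n → ℝ) :
    signAvg n (fun s => (∑ i, s i * x i) ^ 2) = ∑ i, x i ^ 2 := by
  simpa using signAvg_norm_sq (0 : ℝ) x

/-- Averaging over `c ± x 0` removes the odd powers; the induction step then has slack `2 (x 0)⁴`.
-/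
theorem signAvg_pow_four_le {n : ℕ} (c : ℝ) (x : Fin n → ℝ) :
    signAvg n (fun s => (c + ∑ i, s i * x i) ^ 4) ≤
      c ^ 4 + 6 * c ^ 2 * ∑ i, x i ^ 2 + 3 * (∑ i, x i ^ 2) ^ 2 := by
  induction n generalizing c with
  | zero => simp [signAvg]
  | succ n ih =>
    simp only [signAvg, Fin.sum_univ_succ, Fin.cons_zero, Fin.cons_succ, ← add_assoc, one_mul,
      neg_mul]
    have h1 := ih (c + x 0) (fun i => x i.succ)
    have h2 := ih (c + -x 0) (fun i => x i.succ)
    nlinarith [sq_nonneg (x 0 ^ 2)]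

/-- Khintchine's inequality. -/
theorem sqrt_sum_sq_le_signAvg {n : ℕ} (x : Fin n → ℝ) :
    Real.sqrt (∑ i, x i ^ 2) ≤ 2 * signAvg n (fun s => |∑ i, s i * x i|) := by
  set σ := Real.sqrt (∑ i, x i ^ 2) with hσ
  have hnn : 0 ≤ ∑ i, x i ^ 2 := Finset.sum_nonneg fun i _ => sq_nonneg _
  have hσ2 : ∑ i, x i ^ 2 = σ ^ 2 := (Real.sq_sqrt hnn).symm
  have hσ0 : 0 ≤ σ := Real.sqrt_nonneg _
  rcases hσ0.eq_or_lt with h0 | hpos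
  · rw [← h0]
    have := signAvg_mono (n := n) (f := fun _ => 0) (g := fun s => |∑ i, s i * x i|)
      (fun s _ => abs_nonneg _)
    rw [signAvg_const] at this
    linarith
  -- Averaged at `t = |∑ s i x i|`, with second moment `σ²` and fourth moment at most `3σ⁴`, this
  -- gives `6σ⁴ ≤ 12σ³ E|∑ s i x i|`. After division by `t` it is a cubic whose minimum on `t ≥ 0`
  -- is at `√3 σ`; `7/4` approximates `√3`.
  have key : ∀ t : ℝ, 0 ≤ t → 9 * σ ^ 2 * t ^ 2 ≤ t ^ 4 + 12 * σ ^ 3 * t := by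
    intro t ht
    have : 0 ≤ t ^ 3 - 9 * σ ^ 2 * t + 12 * σ ^ 3 := by
      nlinarith [mul_nonneg (sq_nonneg (t - 7 / 4 * σ)) (by positivity : 0 ≤ t + 7 / 2 * σ),
        mul_nonneg (sq_nonneg σ) ht, pow_pos hpos 3]
    nlinarith [mul_nonneg ht this]
  have h1 := signAvg_mono (n := n) (f := fun s => 9 * σ ^ 2 * (∑ i, s i * x i) ^ 2)
    (g := fun s => (0 + ∑ i, s i * x i) ^ 4 + 12 * σ ^ 3 * |∑ i, s i * x i|) (fun s _ => by
      have := key _ (abs_nonneg (∑ i, s i * x i))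
      rw [zero_add]
      rwa [sq_abs, Even.pow_abs (by decide)] at this)
  rw [signAvg_const_mul, signAvg_add, signAvg_const_mul, signAvg_sq] at h1
  have h2 := signAvg_pow_four_le 0 x
  rw [hσ2] at h1 h2
  have h3 : 6 * σ ^ 3 * σ ≤ 6 * σ ^ 3 * (2 * signAvg n (fun s => |∑ i, s i * x i|)) := by
    nlinarith
  exact le_of_mul_le_mul_left h3 (by positivity)

/-! ### The contraction principle. -/

theorem abs_add_sum_sign_mul_le {ι : Type*} {n : ℕ} {s : Fin n → ℝ} (hs : IsSignVec s) {A : ι → ℝ}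
    {t : ι → Fin n → ℝ} {C D : ℝ} (hA : ∀ v, |A v| ≤ C) (ht : ∀ v i, |t v i| ≤ D) :
    ∀ v, |A v + ∑ i, s i * t v i| ≤ C + n * D := fun v => by
  have h : |∑ i, s i * t v i| ≤ ∑ _i : Fin n, D :=
    (Finset.abs_sum_le_sum_abs _ _).trans (Finset.sum_le_sum fun i _ => by
      rw [abs_mul, hs.abs, one_mul]; exact ht v i)
  simp only [Finset.sum_const, Finset.card_univ, Fintype.card_fin, nsmul_eq_mul] at h
  exact (abs_add_le _ _).trans (add_le_add (hA v) h)

theorem bddAbove_range_of_abs_le {ι : Type*} {A : ι → ℝ} {C : ℝ} (hA : ∀ v, |A v| ≤ C) :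
    BddAbove (Set.range A) := ⟨C, by rintro _ ⟨v, rfl⟩; exact (le_abs_self _).trans (hA v)⟩

/-- For near-maximizers `v`, `w` of the two left suprema, choose the sign with `|t v| = ±t v`; then
`-|t w| ≤ ∓t w`, so `v` and `w` compete in opposite suprema on the right. -/
theorem iSup_add_abs_add_iSup_sub_abs_le {ι : Type*} [Nonempty ι] {A t : ι → ℝ} {C D : ℝ}
    (hA : ∀ v, |A v| ≤ C) (ht : ∀ v, |t v| ≤ D) :
    (⨆ v, (A v + |t v|)) + (⨆ v, (A v - |t v|)) ≤ (⨆ v, (A v + t v)) + ⨆ v, (A v - t v) := by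
  have b1 : BddAbove (Set.range fun v => A v + t v) := bddAbove_range_of_abs_le (C := C + D)
    fun v => (abs_add_le _ _).trans (add_le_add (hA v) (ht v))
  have b2 : BddAbove (Set.range fun v => A v - t v) := bddAbove_range_of_abs_le (C := C + D)
    fun v => (abs_sub _ _).trans (add_le_add (hA v) (ht v))
  rw [← le_sub_iff_add_le]
  refine ciSup_le fun v => ?_
  rw [le_sub_comm]
  refine ciSup_le fun w => ?_
  have h1 := le_ciSup b1 v
  have h2 := le_ciSup b2 v
  have h3 := le_ciSup b1 w
  have h4 := le_ciSup b2 w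
  rcases abs_cases (t v) with h | h <;> rcases abs_cases (t w) with h' | h' <;> linarith

/-- The Ledoux–Talagrand contraction principle for the absolute value. -/
theorem signAvg_iSup_abs_le {ι : Type*} [Nonempty ι] {n : ℕ} {A : ι → ℝ} {t : ι → Fin n → ℝ}
    {C D : ℝ} (hA : ∀ v, |A v| ≤ C) (ht : ∀ v i, |t v i| ≤ D) :
    signAvg n (fun s => ⨆ v, (A v + ∑ i, s i * |t v i|)) ≤
      signAvg n (fun s => ⨆ v, (A v + ∑ i, s i * t v i)) := by
  induction n generalizing A C with
  | zero => simp [signAvg]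
  | succ n ih =>
    simp only [signAvg, Fin.sum_univ_succ, Fin.cons_zero, Fin.cons_succ, ← add_assoc, one_mul,
      neg_mul, ← sub_eq_add_neg]
    -- The induction hypothesis strips the absolute values from the later coordinates, with `±|t v
    -- 0|` absorbed into `A`; `h3` then treats coordinate 0 with the other signs frozen.
    have h1 := ih (A := fun v => A v + |t v 0|) (t := fun v i => t v i.succ) (C := C + D)
      (fun v => (abs_add_le _ _).trans (by rw [abs_abs]; exact add_le_add (hA v) (ht v 0)))
      (fun v i => ht v i.succ)
    have h2 := ih (A := fun v => A v - |t v 0|) (t := fun v i => t v i.succ) (C := C + D)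
      (fun v => (abs_sub _ _).trans (by rw [abs_abs]; exact add_le_add (hA v) (ht v 0)))
      (fun v i => ht v i.succ)
    have h3 : signAvg n (fun s => (⨆ v, (A v + |t v 0| + ∑ i, s i * t v i.succ)) +
          ⨆ v, (A v - |t v 0| + ∑ i, s i * t v i.succ)) ≤
        signAvg n (fun s => (⨆ v, (A v + t v 0 + ∑ i, s i * t v i.succ)) +
          ⨆ v, (A v - t v 0 + ∑ i, s i * t v i.succ)) := by
      refine signAvg_mono fun s hs => ?_
      have := iSup_add_abs_add_iSup_sub_abs_le (A := fun v => A v + ∑ i, s i * t v i.succ)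
        (t := fun v => t v 0) (abs_add_sum_sign_mul_le hs hA fun v i => ht v i.succ) (fun v => ht v 0)
      simpa only [add_right_comm, add_sub_right_comm] using this
    rw [signAvg_add, signAvg_add] at h3
    linarith

/-! ### Rounding to one vector, and the Rademacher bound. -/

section Rounding

variable {E : Type*} [NormedAddCommGroup E] [InnerProductSpace ℝ E]

/-- The supremum of `∑ᵢ |⟨v, xᵢ⟩|` over the unit ball. -/
noncomputable def ballSup {k : ℕ} (x : Fin k → E) : ℝ :=
  ⨆ v : Metric.closedBall (0 : E) 1, ∑ i, |inner ℝ (v : E) (x i)|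

theorem abs_inner_le_of_mem_closedBall (v : Metric.closedBall (0 : E) 1) (x : E) :
    |inner ℝ (v : E) x| ≤ ‖x‖ := by
  have hv : ‖(v : E)‖ ≤ 1 := mem_closedBall_zero_iff.1 v.2
  exact (abs_real_inner_le_norm _ _).trans (mul_le_of_le_one_left (norm_nonneg _) hv)

instance : Nonempty (Metric.closedBall (0 : E) 1) := ⟨⟨0, by simp⟩⟩

theorem bddAbove_ballSup {k : ℕ} (x : Fin k → E) :
    BddAbove (Set.range fun v : Metric.closedBall (0 : E) 1 => ∑ i, |inner ℝ (v : E) (x i)|) :=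
  ⟨∑ i, ‖x i‖, by
    rintro _ ⟨v, rfl⟩; exact Finset.sum_le_sum fun i _ => abs_inner_le_of_mem_closedBall v _⟩

theorem sum_abs_inner_le_ballSup {k : ℕ} (x : Fin k → E) (c : E) :
    ∑ i, |inner ℝ c (x i)| ≤ ‖c‖ * ballSup x := by
  rcases eq_or_ne c 0 with rfl | hc
  · simp
  have hc' : 0 < ‖c‖ := norm_pos_iff.2 hc
  have h := le_ciSup (bddAbove_ballSup x)
    (⟨‖c‖⁻¹ • c, by simp [norm_smul, hc'.ne']⟩ : Metric.closedBall (0 : E) 1)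
  simp only [inner_smul_left, abs_mul, ← Finset.mul_sum] at h
  have h2 := mul_le_mul_of_nonneg_left h hc'.le
  simp only [RCLike.conj_to_real, abs_inv, abs_norm] at h2
  rw [← mul_assoc, mul_inv_cancel₀ hc'.ne', one_mul] at h2
  exact h2

theorem ballSup_nonneg {k : ℕ} (x : Fin k → E) : 0 ≤ ballSup x :=
  Real.iSup_nonneg fun _ => Finset.sum_nonneg fun _ _ => abs_nonneg _

/-- Rounding of the relaxation of the `2 → 1` norm. -/
theorem sum_sqrt_le_ballSup {n k : ℕ} (c : Fin n → E) (hc : ∑ a, ‖c a‖ ^ 2 ≤ 1) (x : Fin k → E) :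
    ∑ i, Real.sqrt (∑ a, inner ℝ (c a) (x i) ^ 2) ≤ 2 * ballSup x := by
  have h1 : ∑ i, Real.sqrt (∑ a, inner ℝ (c a) (x i) ^ 2) ≤
      2 * signAvg n (fun s => ∑ i, |inner ℝ (∑ a, s a • c a) (x i)|) := by
    rw [signAvg_sum, Finset.mul_sum]
    refine Finset.sum_le_sum fun i _ => ?_
    simpa only [sum_inner, inner_smul_left, RCLike.conj_to_real] using
      sqrt_sum_sq_le_signAvg fun a => inner ℝ (c a) (x i)
  -- `‖c‖ ≤ (1 + ‖c‖²) / 2` trades the norm for its square, whose average over signs is exactly `∑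
  -- ‖c a‖² ≤ 1`.
  have h2 : signAvg n (fun s => ∑ i, |inner ℝ (∑ a, s a • c a) (x i)|) ≤
      signAvg n (fun s => ballSup x / 2 * (1 + ‖0 + ∑ a, s a • c a‖ ^ 2)) := by
    refine signAvg_mono fun s _ => (sum_abs_inner_le_ballSup x _).trans ?_
    rw [zero_add]
    nlinarith [mul_nonneg (ballSup_nonneg x) (sq_nonneg (‖∑ a, s a • c a‖ - 1))]
  rw [signAvg_const_mul, signAvg_add, signAvg_const, signAvg_norm_sq, norm_zero] at h2
  nlinarith [ballSup_nonneg x]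

/-- The averaged Rademacher bound for `∑ᵢ sᵢ |⟨v, xᵢ⟩|` over the unit ball. -/
theorem signAvg_iSup_abs_inner_le {k : ℕ} (x : Fin k → E) :
    signAvg k (fun s => ⨆ v : Metric.closedBall (0 : E) 1, ∑ i, s i * |inner ℝ (v : E) (x i)|) ≤
      Real.sqrt (∑ i, ‖x i‖ ^ 2) := by
  have h1 := signAvg_iSup_abs_le (ι := Metric.closedBall (0 : E) 1) (n := k) (A := fun _ => 0)
    (t := fun v i => inner ℝ (v : E) (x i)) (C := 0) (D := ∑ i, ‖x i‖) (by simp) (fun v i =>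
      (abs_inner_le_of_mem_closedBall v _).trans
        (Finset.single_le_sum (f := fun i => ‖x i‖) (fun _ _ => norm_nonneg _) (Finset.mem_univ i)))
  simp only [zero_add] at h1
  refine h1.trans ?_
  set σ := Real.sqrt (∑ i, ‖x i‖ ^ 2) with hσ
  have hnn : 0 ≤ ∑ i, ‖x i‖ ^ 2 := Finset.sum_nonneg fun i _ => sq_nonneg _
  have hσ2 : ∑ i, ‖x i‖ ^ 2 = σ ^ 2 := (Real.sq_sqrt hnn).symm
  have hle : ∀ s : Fin k → ℝ, (⨆ v : Metric.closedBall (0 : E) 1, ∑ i, s i * inner ℝ (v : E) (x i))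
      ≤ ‖0 + ∑ i, s i • x i‖ := fun s => ciSup_le fun v => by
    have : ∑ i, s i * inner ℝ (v : E) (x i) = inner ℝ (v : E) (∑ i, s i • x i) := by
      simp [inner_sum, inner_smul_right]
    rw [this, zero_add]
    exact (le_abs_self _).trans (abs_inner_le_of_mem_closedBall v _)
  have h2 : signAvg k (fun s => ⨆ v : Metric.closedBall (0 : E) 1,
      ∑ i, s i * inner ℝ (v : E) (x i)) ≤ signAvg k (fun s => ‖0 + ∑ i, s i • x i‖) :=
    signAvg_mono fun s _ => hle s
  refine h2.trans ?_
  rcases (show 0 ≤ σ from Real.sqrt_nonneg _).eq_or_lt with h0 | hpos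
  · have hx : ∀ i, x i = 0 := fun i => by
      have := (Finset.sum_eq_zero_iff_of_nonneg fun i _ => sq_nonneg ‖x i‖).1
        (by rw [hσ2]; nlinarith) i (Finset.mem_univ i)
      simpa using this
    simp [hx, signAvg_const, hσ]
  -- Jensen's inequality for the square, through `2σN ≤ σ² + N²`; cancelling `σ` is why `σ = 0` is
  -- treated apart.
  have h3 := signAvg_mono (n := k) (f := fun s => 2 * σ * ‖0 + ∑ i, s i • x i‖)
    (g := fun s => σ ^ 2 + ‖0 + ∑ i, s i • x i‖ ^ 2) (fun s _ => by
      nlinarith [sq_nonneg (σ - ‖0 + ∑ i, s i • x i‖)])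
  rw [signAvg_const_mul, signAvg_add, signAvg_const, signAvg_norm_sq, hσ2, norm_zero] at h3
  nlinarith

end Rounding

/-! ### The bounded differences inequality. -/

section McDiarmid

variable {E : Type*} [MeasurableSpace E]

/-- The exponential moment bound behind McDiarmid's bounded differences inequality. -/
theorem integral_exp_pi_le_of_boundedDifferences (ν : Measure E) [IsProbabilityMeasure ν] {n : ℕ}
    (f : (Fin n → E) → ℝ) (hf : Measurable f) {C : ℝ} (hC : ∀ x, |f x| ≤ C)
    (hd : ∀ x i y, |f (Function.update x i y) - f x| ≤ 1) (l : ℝ) :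
    ∫ x, Real.exp (l * (f x - ∫ y, f y ∂Measure.pi fun _ => ν)) ∂Measure.pi (fun _ => ν) ≤
      Real.exp (n * l ^ 2 / 8) := by
  induction n with
  | zero =>
    have : ∀ x : Fin 0 → E, f x = f Fin.elim0 := fun x => congrArg f (Subsingleton.elim _ _)
    simp [this]
  | succ n ih =>
    set π := Measure.pi (fun _ : Fin n => ν) with hπ
    have hmp : MeasurePreserving (MeasurableEquiv.piFinSuccAbove (fun _ => E) (0 : Fin (n + 1))).symm
        (ν.prod π) (Measure.pi fun _ => ν) :=
      (measurePreserving_piFinSuccAbove (fun _ => ν) (0 : Fin (n + 1))).symm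
    have hsymm : ∀ p : E × (Fin n → E),
        (MeasurableEquiv.piFinSuccAbove (fun _ => E) (0 : Fin (n + 1))).symm p =
          (Fin.cons p.1 p.2 : Fin (n + 1) → E) := fun p => by
      simp [MeasurableEquiv.piFinSuccAbove, Fin.insertNthEquiv]
    have hmeas : Measurable fun p : E × (Fin n → E) => f (Fin.cons p.1 p.2) := by
      have := hf.comp (MeasurableEquiv.piFinSuccAbove (fun _ => E) (0 : Fin (n + 1))).symm.measurable
      simpa only [Function.comp_def, hsymm] using this
    have hint : Integrable (fun p : E × (Fin n → E) => f (Fin.cons p.1 p.2)) (ν.prod π) :=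
      Integrable.of_bound hmeas.aestronglyMeasurable C (Filter.Eventually.of_forall fun p => hC _)
    -- Averaging out the first coordinate keeps the bounded differences, so induction applies to
    -- `g`; the fluctuation `f - g` is left to Hoeffding's lemma with the other coordinates fixed.
    set g : (Fin n → E) → ℝ := fun y => ∫ x, f (Fin.cons x y) ∂ν with hg
    have hgm : Measurable g := by
      have := (hmeas.stronglyMeasurable).integral_prod_left' (μ := ν)
      exact this.measurable
    have hsec : ∀ y, Measurable fun x => f (Fin.cons x y : Fin (n + 1) → E) := fun y =>
      hmeas.comp (measurable_id.prodMk measurable_const)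
    have hsint : ∀ y, Integrable (fun x => f (Fin.cons x y : Fin (n + 1) → E)) ν := fun y =>
      Integrable.of_bound (hsec y).aestronglyMeasurable C (Filter.Eventually.of_forall fun p => hC _)
    have hgC : ∀ y, |g y| ≤ C := fun y => by
      simpa using norm_integral_le_of_norm_le_const (μ := ν) (f := fun x => f (Fin.cons x y))
        (C := C) (Filter.Eventually.of_forall fun p => hC _)
    have hgd : ∀ x i y, |g (Function.update x i y) - g x| ≤ 1 := fun x i y => by
      simp only [hg]
      rw [← integral_sub (hsint _) (hsint _)]
      have := norm_integral_le_of_norm_le_const (μ := ν) (C := 1)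
        (f := fun z => f (Fin.cons z (Function.update x i y)) - f (Fin.cons z x))
        (Filter.Eventually.of_forall fun z => by
          rw [Fin.cons_update]; exact hd _ _ _)
      simpa using this
    have hm : ∫ y, f y ∂Measure.pi (fun _ : Fin (n + 1) => ν) = ∫ y, g y ∂π := by
      rw [← hmp.integral_comp']
      simp only [hsymm]
      exact integral_prod_symm _ hint
    have hexpint : Integrable (fun p : E × (Fin n → E) =>
        Real.exp (l * (f (Fin.cons p.1 p.2) - ∫ y, g y ∂π))) (ν.prod π) := by
      refine Integrable.of_bound ((hmeas.sub_const _).const_mul l).exp.aestronglyMeasurable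
        (Real.exp (|l| * (C + |∫ y, g y ∂π|)))
        (Filter.Eventually.of_forall fun p => ?_)
      rw [Real.norm_eq_abs, Real.abs_exp]
      refine Real.exp_le_exp.2 ((le_abs_self _).trans ?_)
      rw [abs_mul]
      exact mul_le_mul_of_nonneg_left ((abs_sub _ _).trans (add_le_add (hC _) le_rfl)) (abs_nonneg _)
    have hgexp : Integrable (fun y => Real.exp (l * (g y - ∫ y, g y ∂π))) π := by
      refine Integrable.of_bound (by fun_prop) (Real.exp (|l| * (C + |∫ y, g y ∂π|)))
        (Filter.Eventually.of_forall fun p => ?_)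
      rw [Real.norm_eq_abs, Real.abs_exp]
      refine Real.exp_le_exp.2 ((le_abs_self _).trans ?_)
      rw [abs_mul]
      exact mul_le_mul_of_nonneg_left ((abs_sub _ _).trans (add_le_add (hgC _) le_rfl))
        (abs_nonneg _)
    have hoeff : ∀ y, ∫ x, Real.exp (l * (f (Fin.cons x y) - g y)) ∂ν ≤ Real.exp (l ^ 2 / 8) := by
      intro y
      have : Nonempty E := nonempty_of_isProbabilityMeasure ν
      have hbdd : BddBelow (Set.range fun x => f (Fin.cons x y : Fin (n + 1) → E)) :=
        ⟨-C, by rintro _ ⟨x, rfl⟩; exact (abs_le.1 (hC _)).1⟩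
      -- As a function of the first coordinate, `f` stays in `[a, a + 1]`; an interval of length 1
      -- gives variance proxy `1/4`.
      set a := ⨅ x, f (Fin.cons x y : Fin (n + 1) → E) with ha
      have hmem : ∀ x, f (Fin.cons x y : Fin (n + 1) → E) ∈ Set.Icc a (a + 1) := fun x => by
        refine ⟨ciInf_le hbdd x, ?_⟩
        rw [← sub_le_iff_le_add]
        refine le_ciInf fun z => ?_
        have := hd (Fin.cons z y) 0 x
        rw [Fin.update_cons_zero] at this
        linarith [(abs_le.1 this).2]
      have h := (hasSubgaussianMGF_of_mem_Icc (μ := ν) (hsec y).aemeasurable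
        (Filter.Eventually.of_forall hmem)).mgf_le l
      rw [mgf] at h
      refine h.trans (le_of_eq ?_)
      congr 1
      simp
      ring
    rw [hm, ← hmp.integral_comp']
    simp only [hsymm]
    rw [integral_prod_symm _ hexpint]
    calc ∫ y, ∫ x, Real.exp (l * (f (Fin.cons x y) - ∫ y, g y ∂π)) ∂ν ∂π
        ≤ ∫ y, Real.exp (l ^ 2 / 8) * Real.exp (l * (g y - ∫ y, g y ∂π)) ∂π := by
          refine integral_mono hexpint.integral_prod_right (hgexp.const_mul _) fun y => ?_
          have : ∀ x, Real.exp (l * (f (Fin.cons x y : Fin (n + 1) → E) - ∫ y, g y ∂π)) =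
              Real.exp (l * (f (Fin.cons x y) - g y)) * Real.exp (l * (g y - ∫ y, g y ∂π)) :=
            fun x => by rw [← Real.exp_add]; ring_nf
          simp only [this]
          rw [integral_mul_const]
          exact mul_le_mul_of_nonneg_right (hoeff y) (Real.exp_nonneg _)
      _ = Real.exp (l ^ 2 / 8) * ∫ y, Real.exp (l * (g y - ∫ y, g y ∂π)) ∂π :=
          integral_const_mul _ _
      _ ≤ Real.exp (l ^ 2 / 8) * Real.exp (n * l ^ 2 / 8) :=
          mul_le_mul_of_nonneg_left (ih g hgm hgC hgd) (Real.exp_nonneg _)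
      _ = Real.exp ((n + 1 : ℕ) * l ^ 2 / 8) := by
          rw [← Real.exp_add]; push_cast; ring_nf

/-- McDiarmid's bounded differences inequality. -/
theorem measureReal_pi_ge_le_of_boundedDifferences (ν : Measure E) [IsProbabilityMeasure ν] {n : ℕ}
    (hn : 0 < n) (f : (Fin n → E) → ℝ) (hf : Measurable f) {C : ℝ} (hC : ∀ x, |f x| ≤ C)
    (hd : ∀ x i y, |f (Function.update x i y) - f x| ≤ 1) {ε : ℝ} (hε : 0 ≤ ε) :
    (Measure.pi fun _ => ν).real {x | ε ≤ f x - ∫ y, f y ∂Measure.pi fun _ => ν} ≤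
      Real.exp (-2 * ε ^ 2 / n) := by
  set m := ∫ y, f y ∂Measure.pi fun _ => ν with hm
  have hn' : (0 : ℝ) < n := by exact_mod_cast hn
  -- `4ε / n` minimizes the Chernoff exponent `-lε + n l² / 8` over `l`.
  have hint : Integrable (fun x => Real.exp (4 * ε / n * (f x - m))) (Measure.pi fun _ => ν) := by
    refine Integrable.of_bound (by fun_prop) (Real.exp (4 * ε / n * (C + |m|)))
      (Filter.Eventually.of_forall fun p => ?_)
    rw [Real.norm_eq_abs, Real.abs_exp]
    refine Real.exp_le_exp.2 (mul_le_mul_of_nonneg_left ?_ (by positivity))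
    exact (le_abs_self _).trans ((abs_sub _ _).trans (add_le_add (hC _) le_rfl))
  refine (measure_ge_le_exp_mul_mgf (X := fun x => f x - m) ε (t := 4 * ε / n) (by positivity)
    hint).trans ?_
  have h := integral_exp_pi_le_of_boundedDifferences ν f hf hC hd (4 * ε / n)
  refine (mul_le_mul_of_nonneg_left h (Real.exp_nonneg _)).trans (le_of_eq ?_)
  rw [← Real.exp_add]
  congr 1
  field_simp
  ring

end McDiarmid

/-! ### Measurability, integrability and exchangeability for the suprema. -/

theorem signAvg_comp_neg {n : ℕ} (f : (Fin n → ℝ) → ℝ) :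
    signAvg n (fun s => f (-s)) = signAvg n f := by
  induction n with
  | zero => exact congrArg f (Subsingleton.elim _ _)
  | succ n ih =>
    have h : ∀ (a : ℝ) (s : Fin n → ℝ), -(Fin.cons a s : Fin (n + 1) → ℝ) = Fin.cons (-a) (-s) := by
      intro a s
      funext i
      refine Fin.cases ?_ (fun i => ?_) i <;> simp
    simp only [signAvg, h, neg_neg]
    rw [ih (fun s => f (Fin.cons (-1) s)), ih (fun s => f (Fin.cons 1 s)), add_comm]

theorem IsSignVec.neg {n : ℕ} {s : Fin n → ℝ} (hs : IsSignVec s) : IsSignVec (-s) := fun i => by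
  rcases hs i with h | h <;> simp [h]

theorem integral_le_sqrt_integral_sq {Ω : Type*} [MeasurableSpace Ω] {P : Measure Ω}
    [IsProbabilityMeasure P] {X : Ω → ℝ} (hX : MemLp X 2 P) :
    ∫ ω, X ω ∂P ≤ Real.sqrt (∫ ω, X ω ^ 2 ∂P) := by
  refine Real.le_sqrt_of_sq_le ?_
  have h := variance_nonneg X P
  rw [variance_eq_sub hX] at h
  simpa using h

section Supremum

variable {V : Type*} {Ω : Type*} [TopologicalSpace Ω] [MeasurableSpace Ω]
  [OpensMeasurableSpace Ω] {F : V → Ω → ℝ} {g : Ω → ℝ}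

/-- The index set may be uncountable; measurability comes from lower semicontinuity of a pointwise
bounded supremum of continuous functions. -/
theorem measurable_iSup_of_continuous (hF : ∀ v, Continuous (F v)) (hg : ∀ v x, |F v x| ≤ g x) :
    Measurable fun x => ⨆ v, F v x :=
  (lowerSemicontinuous_ciSup (fun x => bddAbove_range_of_abs_le fun v => hg v x)
    fun v => (hF v).lowerSemicontinuous).measurable

theorem abs_iSup_le_of_abs_le [Nonempty V] {a : V → ℝ} {c : ℝ} (h : ∀ v, |a v| ≤ c) : |⨆ v, a v| ≤ c :=
  abs_le.2 ⟨(abs_le.1 (h (Classical.arbitrary V))).1.trans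
    (le_ciSup (bddAbove_range_of_abs_le h) _), ciSup_le fun v => (abs_le.1 (h v)).2⟩

theorem integrable_iSup_of_continuous [Nonempty V] {P : Measure Ω} (hF : ∀ v, Continuous (F v))
    (hg : ∀ v x, |F v x| ≤ g x) (hint : Integrable g P) : Integrable (fun x => ⨆ v, F v x) P :=
  hint.mono' (measurable_iSup_of_continuous hF hg).aestronglyMeasurable
    (Filter.Eventually.of_forall fun x => abs_iSup_le_of_abs_le fun v => hg v x)

end Supremum

theorem integrable_sum_norm {E : Type*} [NormedAddCommGroup E] [MeasurableSpace E]
    (ν : Measure E) [IsProbabilityMeasure ν] {k : ℕ}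
    (hν : Integrable (fun x => ‖x‖) ν) :
    Integrable (fun x : Fin k → E => ∑ i, ‖x i‖) (Measure.pi fun _ => ν) :=
  integrable_finsetSum _ fun i _ =>
    (measurePreserving_eval (fun _ : Fin k => ν) i).integrable_comp_of_integrable hν

theorem abs_sum_sign_mul_abs_inner_le {E : Type*} [NormedAddCommGroup E]
    [InnerProductSpace ℝ E] {k : ℕ} {s : Fin k → ℝ} (hs : IsSignVec s)
    (v : Metric.closedBall (0 : E) 1) (x : Fin k → E) :
    |∑ i, (s i * |inner ℝ (v : E) (x i)|)| ≤ ∑ i, ‖x i‖ :=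
  (Finset.abs_sum_le_sum_abs _ _).trans (Finset.sum_le_sum fun i _ => by
    rw [abs_mul, hs.abs, one_mul, abs_abs]; exact abs_inner_le_of_mem_closedBall v _)

theorem abs_sum_abs_inner_sub_le {E : Type*} [NormedAddCommGroup E]
    [InnerProductSpace ℝ E] {k : ℕ} (v : Metric.closedBall (0 : E) 1) (x y : Fin k → E) :
    |∑ i, (|inner ℝ (v : E) (x i)| - |inner ℝ (v : E) (y i)|)| ≤ ∑ i, ‖x i‖ + ∑ i, ‖y i‖ := by
  rw [← Finset.sum_add_distrib]
  refine (Finset.abs_sum_le_sum_abs _ _).trans (Finset.sum_le_sum fun i _ => ?_)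
  refine (abs_sub _ _).trans ?_
  rw [abs_abs, abs_abs]
  exact add_le_add (abs_inner_le_of_mem_closedBall v _) (abs_inner_le_of_mem_closedBall v _)

/-- The expected norm of the sample is controlled by the second moment. -/
theorem integral_sqrt_sum_norm_sq_le {E : Type*} [NormedAddCommGroup E]
    [MeasurableSpace E] [BorelSpace E] [SecondCountableTopology E] (ν : Measure E) [IsProbabilityMeasure ν] {k : ℕ}
    (hν : MemLp (fun x : E => x) 2 ν) :
    Integrable (fun x : Fin k → E => Real.sqrt (∑ i, ‖x i‖ ^ 2)) (Measure.pi fun _ => ν) ∧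
    ∫ x : Fin k → E, Real.sqrt (∑ i, ‖x i‖ ^ 2) ∂(Measure.pi fun _ => ν) ≤
      Real.sqrt (k * ∫ x, ‖x‖ ^ 2 ∂ν) := by
  have hsq : Integrable (fun x : E => ‖x‖ ^ 2) ν := hν.integrable_norm_pow two_ne_zero
  have hi : ∀ i : Fin k, Integrable (fun x : Fin k → E => ‖x i‖ ^ 2) (Measure.pi fun _ => ν) :=
    fun i => (measurePreserving_eval (fun _ : Fin k => ν) i).integrable_comp_of_integrable hsq
  have hpow : ∀ x : Fin k → E, Real.sqrt (∑ i, ‖x i‖ ^ 2) ^ 2 = ∑ i, ‖x i‖ ^ 2 := fun x =>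
    Real.sq_sqrt (Finset.sum_nonneg fun i _ => sq_nonneg _)
  have hL : MemLp (fun x : Fin k → E => Real.sqrt (∑ i, ‖x i‖ ^ 2)) 2 (Measure.pi fun _ => ν) := by
    rw [memLp_two_iff_integrable_sq
      ((by fun_prop : Continuous fun x : Fin k → E =>
        Real.sqrt (∑ i, ‖x i‖ ^ 2)).aestronglyMeasurable)]
    simp only [hpow]
    exact integrable_finsetSum _ fun i _ => hi i
  refine ⟨hL.integrable one_le_two, (integral_le_sqrt_integral_sq hL).trans (le_of_eq ?_)⟩
  simp only [hpow]
  rw [integral_finsetSum _ fun i _ => hi i]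
  congr 1
  have : ∀ i : Fin k, ∫ x : Fin k → E, ‖x i‖ ^ 2 ∂(Measure.pi fun _ => ν) = ∫ x, ‖x‖ ^ 2 ∂ν :=
    fun i => integral_comp_eval (μ := fun _ : Fin k => ν) (f := fun y => ‖y‖ ^ 2)
      hsq.aestronglyMeasurable
  simp [this]

theorem measurePreserving_swap_coords {E : Type*} [MeasurableSpace E] (ν : Measure E) [IsProbabilityMeasure ν] {k : ℕ}
    (q : Fin k → Prop) [DecidablePred q] :
    MeasurePreserving (fun (z : Fin k → E × E) i => if q i then z i else (z i).swap)
      (Measure.pi fun _ => ν.prod ν) (Measure.pi fun _ => ν.prod ν) :=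
  measurePreserving_pi (f := fun i (p : E × E) => if q i then p else p.swap) _ _ fun i => by
    by_cases h : q i
    · simpa only [h, if_true] using! MeasurePreserving.id _
    · simpa [h] using Measure.measurePreserving_swap

/-! ### Symmetrization and the mean of `ballSup`. -/

section Symmetrization

variable {E : Type*} [NormedAddCommGroup E] [InnerProductSpace ℝ E] [MeasurableSpace E]
  [BorelSpace E] [SecondCountableTopology E]

theorem integrable_iSup_sign_abs_inner (ν : Measure E) [IsProbabilityMeasure ν] {k : ℕ}
    (hν : Integrable (fun x => ‖x‖) ν) {s : Fin k → ℝ} (hs : IsSignVec s) :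
    Integrable (fun x : Fin k → E => ⨆ v : Metric.closedBall (0 : E) 1,
      ∑ i, s i * |inner ℝ (v : E) (x i)|) (Measure.pi fun _ => ν) :=
  integrable_iSup_of_continuous (fun v => by fun_prop)
    (fun v x => abs_sum_sign_mul_abs_inner_le hs v x) (integrable_sum_norm ν hν)

/-- Symmetrization by a ghost sample, for one fixed sign vector. -/
theorem integral_iSup_centered_le (ν : Measure E) [IsProbabilityMeasure ν] {k : ℕ}
    (hν : Integrable (fun x => ‖x‖) ν) {s : Fin k → ℝ} (hs : IsSignVec s) :
    ∫ x : Fin k → E, (⨆ v : Metric.closedBall (0 : E) 1,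
        ∑ i, (|inner ℝ (v : E) (x i)| - ∫ y, |inner ℝ (v : E) y| ∂ν)) ∂(Measure.pi fun _ => ν) ≤
      ∫ x : Fin k → E, (⨆ v : Metric.closedBall (0 : E) 1,
        ∑ i, s i * |inner ℝ (v : E) (x i)|) ∂(Measure.pi fun _ => ν) +
      ∫ x : Fin k → E, (⨆ v : Metric.closedBall (0 : E) 1,
        ∑ i, (-s) i * |inner ℝ (v : E) (x i)|) ∂(Measure.pi fun _ => ν) := by
  classical
  set π := Measure.pi (fun _ : Fin k => ν) with hπ
  set ρ := Measure.pi (fun _ : Fin k => ν.prod ν) with hρ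
  set H : (Fin k → E) × (Fin k → E) → ℝ := fun p => ⨆ v : Metric.closedBall (0 : E) 1,
    ∑ i, (|inner ℝ (v : E) (p.1 i)| - |inner ℝ (v : E) (p.2 i)|) with hH
  have hsum := integrable_sum_norm (k := k) ν hν
  have hHint : Integrable H (π.prod π) :=
    integrable_iSup_of_continuous (fun v => by fun_prop)
      (fun v p => abs_sum_abs_inner_sub_le v p.1 p.2) ((hsum.comp_fst π).add (hsum.comp_snd π))
  have hinner : ∀ v : Metric.closedBall (0 : E) 1, Integrable (fun y => |inner ℝ (v : E) y|) ν :=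
    fun v => hν.mono' (by fun_prop) (Filter.Eventually.of_forall fun y => by
      rw [Real.norm_eq_abs, abs_abs]; exact abs_inner_le_of_mem_closedBall v y)
  have hm : ∀ v : Metric.closedBall (0 : E) 1, |∫ y, |inner ℝ (v : E) y| ∂ν| ≤ ∫ y, ‖y‖ ∂ν :=
    fun v => by
      rw [abs_of_nonneg (integral_nonneg fun y => abs_nonneg _)]
      exact integral_mono (hinner v) hν fun y => abs_inner_le_of_mem_closedBall v y
  have hD : Integrable (fun x : Fin k → E => ⨆ v : Metric.closedBall (0 : E) 1,
      ∑ i, (|inner ℝ (v : E) (x i)| - ∫ y, |inner ℝ (v : E) y| ∂ν)) π := by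
    refine integrable_iSup_of_continuous (fun v => by fun_prop)
      (g := fun x => ∑ i, ‖x i‖ + ∑ _i : Fin k, ∫ y, ‖y‖ ∂ν) (fun v x => ?_)
      (hsum.add (integrable_const _))
    rw [← Finset.sum_add_distrib]
    refine (Finset.abs_sum_le_sum_abs _ _).trans (Finset.sum_le_sum fun i _ => ?_)
    refine (abs_sub _ _).trans (add_le_add ?_ (hm v))
    rw [abs_abs]
    exact abs_inner_le_of_mem_closedBall v _
  have hghost : ∀ x : Fin k → E, Integrable (fun y => H (x, y)) π := fun x =>
    integrable_iSup_of_continuous (fun v => by fun_prop)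
      (fun v y => abs_sum_abs_inner_sub_le v x y) ((integrable_const _).add hsum)
  -- Each centring constant is an expectation over the ghost sample, and a supremum of integrals is
  -- at most the integral of the supremum.
  have h1 : ∫ x : Fin k → E, (⨆ v : Metric.closedBall (0 : E) 1,
        ∑ i, (|inner ℝ (v : E) (x i)| - ∫ y, |inner ℝ (v : E) y| ∂ν)) ∂π ≤ ∫ p, H p ∂π.prod π := by
    rw [integral_prod _ hHint]
    refine integral_mono hD hHint.integral_prod_left fun x => ciSup_le fun v => ?_
    have hi : ∀ i : Fin k, Integrable (fun y : Fin k → E => |inner ℝ (v : E) (y i)|) π := fun i =>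
      (measurePreserving_eval (fun _ : Fin k => ν) i).integrable_comp_of_integrable (hinner v)
    have : ∑ i, (|inner ℝ (v : E) (x i)| - ∫ y, |inner ℝ (v : E) y| ∂ν) =
        ∫ y : Fin k → E, ∑ i, (|inner ℝ (v : E) (x i)| - |inner ℝ (v : E) (y i)|) ∂π := by
      rw [integral_finsetSum (f := fun i (y : Fin k → E) =>
        |inner ℝ (v : E) (x i)| - |inner ℝ (v : E) (y i)|) _
        fun i _ => (integrable_const _).sub (hi i)]
      refine Finset.sum_congr rfl fun i _ => ?_
      rw [integral_sub (integrable_const _) (hi i),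
        integral_comp_eval (μ := fun _ : Fin k => ν) (f := fun y => |inner ℝ (v : E) y|)
          (hinner v).aestronglyMeasurable]
      simp
    rw [this]
    refine integral_mono (integrable_finsetSum _ fun i _ => (integrable_const _).sub (hi i))
      (hghost x) fun y => ?_
    exact le_ciSup (f := fun v : Metric.closedBall (0 : E) 1 =>
        ∑ i, (|inner ℝ (v : E) (x i)| - |inner ℝ (v : E) (y i)|))
      (bddAbove_range_of_abs_le fun v => abs_sum_abs_inner_sub_le v x y) v
  have hsplit : MeasurePreserving (MeasurableEquiv.arrowProdEquivProdArrow E E (Fin k)) ρ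
      (π.prod π) := measurePreserving_arrowProdEquivProdArrow E E (Fin k) _ _
  -- Exchanging a point with its ghost where `s i = -1` preserves the joint law and multiplies the
  -- `i`-th difference by `s i`.
  have hswap := measurePreserving_swap_coords ν (fun i => s i = 1)
  have hcomp := hsplit.comp hswap
  have hfst : MeasurePreserving (fun z : Fin k → E × E => fun i => (z i).1) ρ π :=
    (measurePreserving_fst (μ := π) (ν := π)).comp hsplit
  have hsnd : MeasurePreserving (fun z : Fin k → E × E => fun i => (z i).2) ρ π :=
    (measurePreserving_snd (μ := π) (ν := π)).comp hsplit
  have hG1 := integrable_iSup_sign_abs_inner ν hν hs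
  have hG2 := integrable_iSup_sign_abs_inner ν hν hs.neg
  refine h1.trans ?_
  have e1 := integral_map (μ := ρ) hfst.measurable.aemeasurable
    (by rw [hfst.map_eq]; exact hG1.aestronglyMeasurable)
  have e2 := integral_map (μ := ρ) hsnd.measurable.aemeasurable
    (by rw [hsnd.map_eq]; exact hG2.aestronglyMeasurable)
  have e3 := integral_map (μ := ρ) hcomp.measurable.aemeasurable
    (by rw [hcomp.map_eq]; exact hHint.aestronglyMeasurable)
  rw [hfst.map_eq] at e1
  rw [hsnd.map_eq] at e2
  rw [hcomp.map_eq] at e3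
  rw [e1, e2, e3]
  refine le_of_le_of_eq ?_ (integral_add (hfst.integrable_comp_of_integrable hG1)
    (hsnd.integrable_comp_of_integrable hG2))
  refine integral_mono (hcomp.integrable_comp_of_integrable hHint)
    ((hfst.integrable_comp_of_integrable hG1).add (hsnd.integrable_comp_of_integrable hG2))
    fun z => ciSup_le fun v => ?_
  have e : ∑ i, (|inner ℝ (v : E) ((if s i = 1 then z i else (z i).swap).1)| -
        |inner ℝ (v : E) ((if s i = 1 then z i else (z i).swap).2)|) =
      ∑ i, s i * |inner ℝ (v : E) (z i).1| + ∑ i, (-s) i * |inner ℝ (v : E) (z i).2| := by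
    rw [← Finset.sum_add_distrib]
    refine Finset.sum_congr rfl fun i _ => ?_
    rcases hs i with h | h
    · simp [h]; ring
    · have : ¬ ((-1 : ℝ) = 1) := by norm_num
      simp [h, this]; ring
  refine e.le.trans (add_le_add ?_ ?_)
  · exact le_ciSup (f := fun v : Metric.closedBall (0 : E) 1 =>
        ∑ i, s i * |inner ℝ (v : E) (z i).1|)
      (bddAbove_range_of_abs_le fun v =>
        abs_sum_sign_mul_abs_inner_le hs v (fun i => (z i).1)) v
  · exact le_ciSup (f := fun v : Metric.closedBall (0 : E) 1 =>
        ∑ i, (-s) i * |inner ℝ (v : E) (z i).2|)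
      (bddAbove_range_of_abs_le fun v =>
        abs_sum_sign_mul_abs_inner_le hs.neg v (fun i => (z i).2)) v

theorem integrable_ballSup (ν : Measure E) [IsProbabilityMeasure ν] {k : ℕ}
    (hν : Integrable (fun x => ‖x‖) ν) :
    Integrable (fun x : Fin k → E => ballSup x) (Measure.pi fun _ => ν) := by
  simpa [ballSup] using integrable_iSup_sign_abs_inner ν hν (s := fun _ : Fin k => 1)
    (fun _ => Or.inl rfl)

/-- The expected `2 → 1` norm of a sample with bounded second moments. -/
theorem integral_ballSup_le (ν : Measure E) [IsProbabilityMeasure ν] {k : ℕ}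
    (hν : MemLp (fun x : E => x) 2 ν) {L : ℝ}
    (hL0 : 0 ≤ L) (hL : ∀ v : E, ∫ x, inner ℝ v x ^ 2 ∂ν ≤ L * ‖v‖ ^ 2) :
    ∫ x : Fin k → E, ballSup x ∂(Measure.pi fun _ => ν) ≤
      2 * Real.sqrt (k * ∫ x, ‖x‖ ^ 2 ∂ν) + k * Real.sqrt L := by
  set π := Measure.pi (fun _ : Fin k => ν) with hπ
  have hν1 : Integrable (fun x => ‖x‖) ν := (hν.integrable one_le_two).norm
  obtain ⟨hsi, hsle⟩ := integral_sqrt_sum_norm_sq_le (k := k) ν hν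
  set D : (Fin k → E) → ℝ := fun x => ⨆ v : Metric.closedBall (0 : E) 1,
    ∑ i, (|inner ℝ (v : E) (x i)| - ∫ y, |inner ℝ (v : E) y| ∂ν) with hDdef
  set G : (Fin k → E) → (Fin k → ℝ) → ℝ := fun x s => ⨆ v : Metric.closedBall (0 : E) 1,
    ∑ i, s i * |inner ℝ (v : E) (x i)| with hG
  have hGi : ∀ s, IsSignVec s → Integrable (fun x => G x s) π := fun s hs =>
    integrable_iSup_sign_abs_inner ν hν1 hs
  have hDle : ∫ x, D x ∂π ≤ 2 * Real.sqrt (k * ∫ x, ‖x‖ ^ 2 ∂ν) := by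
    -- Averaged over all `s`, the terms for `s` and `-s` agree, whence the factor 2.
    have h1 : signAvg k (fun _ => ∫ x, D x ∂π) ≤
        signAvg k (fun s => ∫ x, G x s ∂π + ∫ x, G x (-s) ∂π) :=
      signAvg_mono fun s hs => integral_iSup_centered_le ν hν1 hs
    rw [signAvg_const, signAvg_add, signAvg_comp_neg (fun s => ∫ x, G x s ∂π),
      ← integral_signAvg hGi] at h1
    have h2 : ∫ x, signAvg k (G x) ∂π ≤ ∫ x, Real.sqrt (∑ i, ‖x i‖ ^ 2) ∂π :=
      integral_mono (integrable_signAvg hGi) hsi fun x => signAvg_iSup_abs_inner_le x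
    linarith
  have hmean : ∀ v : Metric.closedBall (0 : E) 1, ∫ y, |inner ℝ (v : E) y| ∂ν ≤ Real.sqrt L := by
    intro v
    have hmem : MemLp (fun y => |inner ℝ (v : E) y|) 2 ν :=
      hν.norm.mono (by fun_prop) (Filter.Eventually.of_forall fun y => by
        rw [Real.norm_eq_abs, abs_abs, norm_norm]; exact abs_inner_le_of_mem_closedBall v y)
    refine (integral_le_sqrt_integral_sq hmem).trans (Real.sqrt_le_sqrt ?_)
    simp only [sq_abs]
    have hv : ‖(v : E)‖ ≤ 1 := mem_closedBall_zero_iff.1 v.2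
    refine (hL v).trans ?_
    exact mul_le_of_le_one_right hL0 (pow_le_one₀ (norm_nonneg _) hv)
  have hm0 : ∀ v : Metric.closedBall (0 : E) 1, 0 ≤ ∫ y, |inner ℝ (v : E) y| ∂ν := fun v =>
    integral_nonneg fun y => abs_nonneg _
  have hDb : ∀ (x : Fin k → E) (v : Metric.closedBall (0 : E) 1),
      |∑ i, (|inner ℝ (v : E) (x i)| - ∫ y, |inner ℝ (v : E) y| ∂ν)| ≤
        ∑ i : Fin k, (‖x i‖ + Real.sqrt L) := fun x v =>
    (Finset.abs_sum_le_sum_abs _ _).trans (Finset.sum_le_sum fun i _ => by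
      refine (abs_sub _ _).trans ?_
      rw [abs_abs, abs_of_nonneg (hm0 v)]
      exact add_le_add (abs_inner_le_of_mem_closedBall v _) (hmean v))
  have hDi : Integrable D π :=
    integrable_iSup_of_continuous (fun v => by fun_prop) (fun v x => hDb x v) (by
      simp only [Finset.sum_add_distrib]
      exact (integrable_sum_norm ν hν1).add (integrable_const _))
  have hpt : ∀ x : Fin k → E, ballSup x ≤ D x + k * Real.sqrt L := fun x => ciSup_le fun v => by
    have h1 := le_ciSup (bddAbove_range_of_abs_le (hDb x)) v
    rw [Finset.sum_sub_distrib] at h1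
    simp only [Finset.sum_const, Finset.card_univ, Fintype.card_fin, nsmul_eq_mul] at h1
    have h2 := mul_le_mul_of_nonneg_left (hmean v) (Nat.cast_nonneg (α := ℝ) k)
    simp only [hDdef]
    linarith
  calc ∫ x : Fin k → E, ballSup x ∂π ≤ ∫ x, (D x + k * Real.sqrt L) ∂π :=
        integral_mono (integrable_ballSup ν hν1) (hDi.add (integrable_const _)) hpt
    _ = ∫ x, D x ∂π + k * Real.sqrt L := by
        rw [integral_add hDi (integrable_const _)]; simp
    _ ≤ _ := by linarith

end Symmetrization

/-! ### Concentration of the truncated relaxation. -/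

section TruncSup

variable {E : Type*} [NormedAddCommGroup E] [InnerProductSpace ℝ E]

/-- Families of `n` vectors whose squared norms sum to at most one. -/
abbrev UnitFamily (E : Type*) [NormedAddCommGroup E] (n : ℕ) : Type _ :=
  {c : Fin n → E // ∑ a, ‖c a‖ ^ 2 ≤ 1}

instance (n : ℕ) : Nonempty (UnitFamily E n) := ⟨⟨0, by simp⟩⟩

/-- The truncated relaxation of `∑ᵢ min 1 (⟨v, xᵢ⟩² / r²)` over the unit ball. -/
noncomputable def truncSup (n : ℕ) {k : ℕ} (r : ℝ) (x : Fin k → E) : ℝ :=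
  ⨆ c : UnitFamily E n, ∑ i, min 1 ((∑ a, inner ℝ (c.1 a) (x i) ^ 2) / r ^ 2)

theorem min_one_div_sq_mem_Icc {n : ℕ} (r : ℝ) (c : Fin n → E) (x : E) :
    min 1 ((∑ a, inner ℝ (c a) x ^ 2) / r ^ 2) ∈ Set.Icc (0 : ℝ) 1 :=
  ⟨le_min zero_le_one (div_nonneg (Finset.sum_nonneg fun _ _ => sq_nonneg _) (sq_nonneg _)),
    min_le_left _ _⟩

theorem abs_sum_min_le {n k : ℕ} (r : ℝ) (c : Fin n → E) (x : Fin k → E) :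
    |∑ i, min 1 ((∑ a, inner ℝ (c a) (x i) ^ 2) / r ^ 2)| ≤ k := by
  rw [abs_of_nonneg (Finset.sum_nonneg fun i _ => (min_one_div_sq_mem_Icc r c (x i)).1)]
  refine (Finset.sum_le_sum fun i _ => (min_one_div_sq_mem_Icc r c (x i)).2).trans ?_
  simp

theorem sum_min_le_truncSup {n k : ℕ} (r : ℝ) (c : UnitFamily E n) (x : Fin k → E) :
    ∑ i, min 1 ((∑ a, inner ℝ (c.1 a) (x i) ^ 2) / r ^ 2) ≤ truncSup n r x :=
  le_ciSup (f := fun c : UnitFamily E n =>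
      ∑ i, min 1 ((∑ a, inner ℝ (c.1 a) (x i) ^ 2) / r ^ 2))
    (bddAbove_range_of_abs_le fun c => abs_sum_min_le r c.1 x) c

theorem abs_truncSup_le (n : ℕ) {k : ℕ} (r : ℝ) (x : Fin k → E) : |truncSup n r x| ≤ k :=
  abs_iSup_le_of_abs_le fun c => abs_sum_min_le r c.1 x

/-- This is what the truncation at 1 buys: one sample point affects one summand, which lies in `[0,
1]` whatever the size of the point. -/
theorem truncSup_update_le (n : ℕ) {k : ℕ} (r : ℝ) (x : Fin k → E) (i : Fin k) (y : E) :
    truncSup n r (Function.update x i y) ≤ truncSup n r x + 1 := by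
  refine ciSup_le fun c => ?_
  have h := sum_min_le_truncSup r c x
  rw [← Finset.add_sum_erase _ _ (Finset.mem_univ i)] at h ⊢
  have h1 : ∀ j ∈ Finset.univ.erase i,
      min 1 ((∑ a, inner ℝ (c.1 a) (Function.update x i y j) ^ 2) / r ^ 2) =
        min 1 ((∑ a, inner ℝ (c.1 a) (x j) ^ 2) / r ^ 2) := fun j hj => by
    rw [Function.update_of_ne (Finset.ne_of_mem_erase hj)]
  rw [Finset.sum_congr rfl h1]
  have h2 := (min_one_div_sq_mem_Icc r c.1 (Function.update x i y i)).2
  have h3 := (min_one_div_sq_mem_Icc r c.1 (x i)).1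
  linarith

theorem abs_truncSup_update_sub_le (n : ℕ) {k : ℕ} (r : ℝ) (x : Fin k → E) (i : Fin k) (y : E) :
    |truncSup n r (Function.update x i y) - truncSup n r x| ≤ 1 := by
  have h1 := truncSup_update_le n r x i y
  have h2 := truncSup_update_le n r (Function.update x i y) i (x i)
  rw [Function.update_idem, Function.update_eq_self] at h2
  exact abs_le.2 ⟨by linarith, by linarith⟩

/-- With `t = √q / r`, `min 1 t² ≤ t`; this passes to the square roots that the rounding bound
controls. -/
theorem truncSup_le_ballSup (n : ℕ) {k : ℕ} {r : ℝ} (hr : 0 < r) (x : Fin k → E) :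
    truncSup n r x ≤ 2 / r * ballSup x := by
  refine ciSup_le fun c => ?_
  have h := sum_sqrt_le_ballSup c.1 c.2 x
  have h1 : ∑ i, min 1 ((∑ a, inner ℝ (c.1 a) (x i) ^ 2) / r ^ 2) ≤
      ∑ i, Real.sqrt (∑ a, inner ℝ (c.1 a) (x i) ^ 2) / r := by
    refine Finset.sum_le_sum fun i _ => ?_
    have hq : 0 ≤ ∑ a, inner ℝ (c.1 a) (x i) ^ 2 := Finset.sum_nonneg fun _ _ => sq_nonneg _
    set t := Real.sqrt (∑ a, inner ℝ (c.1 a) (x i) ^ 2) with ht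
    rw [← Real.sq_sqrt hq, ← ht, ← div_pow]
    have h0 : 0 ≤ t / r := div_nonneg (Real.sqrt_nonneg _) hr.le
    rcases le_total (t / r) 1 with h2 | h2
    · exact (min_le_right _ _).trans (by nlinarith)
    · exact (min_le_left _ _).trans h2
  refine h1.trans ?_
  rw [← Finset.sum_div, div_mul_eq_mul_div]
  exact div_le_div_of_nonneg_right h hr.le

variable [MeasurableSpace E] [BorelSpace E] [SecondCountableTopology E]

theorem measurable_truncSup (n : ℕ) {k : ℕ} (r : ℝ) :
    Measurable fun x : Fin k → E => truncSup n r x :=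
  measurable_iSup_of_continuous (g := fun _ => k)
    (fun c => by
      refine continuous_finsetSum _ fun i _ => continuous_const.min (Continuous.div_const ?_ _)
      fun_prop)
    fun c x => abs_sum_min_le r c.1 x

/-- The truncated relaxation of a sample is small with high probability. -/
theorem measureReal_truncSup_ge_le (ν : Measure E) [IsProbabilityMeasure ν] (n : ℕ) {k : ℕ}
    (hk : 0 < k) (hν : MemLp (fun x : E => x) 2 ν) {L : ℝ} (hL0 : 0 ≤ L)
    (hL : ∀ v : E, ∫ x, inner ℝ v x ^ 2 ∂ν ≤ L * ‖v‖ ^ 2) {r : ℝ} (hr : 0 < r)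
    (hrL : 300 * (Real.sqrt ((∫ x, ‖x‖ ^ 2 ∂ν) / k) + Real.sqrt L) ≤ r) :
    (Measure.pi fun _ : Fin k => ν).real {x | (k : ℝ) / 20 ≤ truncSup n r x} ≤
      Real.exp (-(k / 3200)) := by
  set τ := ∫ x, ‖x‖ ^ 2 ∂ν with hτ
  have hk' : (0 : ℝ) < k := by exact_mod_cast hk
  set m := ∫ x : Fin k → E, truncSup n r x ∂Measure.pi fun _ => ν with hm
  -- The expected `ballSup` is at most `2k (√(τ/k) + √L) ≤ k r / 150`, and `truncSup` costs a
  -- further factor `2 / r`.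
  have hm1 : m ≤ k / 75 := by
    have hb := integral_ballSup_le (k := k) ν hν hL0 hL
    have hbi := integrable_ballSup (k := k) ν (hν.integrable one_le_two).norm
    have h1 : m ≤ ∫ x : Fin k → E, 2 / r * ballSup x ∂Measure.pi fun _ => ν :=
      integral_mono (Integrable.of_bound (measurable_truncSup n r).aestronglyMeasurable k
        (Filter.Eventually.of_forall fun x => abs_truncSup_le n r x)) (hbi.const_mul _)
        fun x => truncSup_le_ballSup n hr x
    rw [integral_const_mul] at h1
    have hs : Real.sqrt (k * τ) = k * Real.sqrt (τ / k) := by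
      rw [show (k : ℝ) * τ = k ^ 2 * (τ / k) by field_simp, Real.sqrt_mul (sq_nonneg _),
        Real.sqrt_sq hk'.le]
    rw [hs] at hb
    have h2 : ∫ x : Fin k → E, ballSup x ∂(Measure.pi fun _ => ν) ≤ k * r / 150 := by
      have := mul_le_mul_of_nonneg_left hrL hk'.le
      have h0 := mul_nonneg hk'.le (Real.sqrt_nonneg L)
      linarith
    refine (h1.trans (mul_le_mul_of_nonneg_left h2 (by positivity))).trans (le_of_eq ?_)
    field_simp
    norm_num
  -- `11/300 = 1/20 - 1/75`. The resulting exponent `2 (11/300)² k = 242 k / 90000` comfortably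
  -- exceeds `k / 3200`.
  have hmc := measureReal_pi_ge_le_of_boundedDifferences ν hk (truncSup n r)
    (measurable_truncSup n r) (abs_truncSup_le n r) (abs_truncSup_update_sub_le n r)
    (ε := 11 / 300 * k) (by positivity)
  refine (measureReal_mono (fun x hx => ?_)).trans (hmc.trans (Real.exp_le_exp.2 ?_))
  · simp only [Set.mem_ofPred_eq] at hx ⊢
    linarith
  · rw [show -2 * (11 / 300 * (k : ℝ)) ^ 2 / k = -(242 / 90000 * k) by field_simp; norm_num]
    linarith

end TruncSup

/-! ### From feasible matrices to the truncated relaxation. -/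

/-- A feasible solution has objective at most the truncated relaxation of the centred sample. -/
theorem MTFeasible.sum_le_truncSup {k d : ℕ} {x : EuclideanSpace ℝ (Fin d)} {r : ℝ} (hr : 0 < r)
    {Z : Fin k → EuclideanSpace ℝ (Fin d)} {X : Matrix (MTIndex k d) (MTIndex k d) ℝ}
    (hX : MTFeasible x r Z X) :
    ∑ i, X (MTIndex.b i) (MTIndex.b i) ≤
      truncSup (Fintype.card (MTIndex k d)) r fun i => Z i - x := by
  obtain ⟨A, hA⟩ : ∃ A : Matrix (MTIndex k d) (MTIndex k d) ℝ, X = A.conjTranspose * A := by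
    open scoped MatrixOrder in
    exact CStarAlgebra.nonneg_iff_eq_star_mul_self.1 hX.posSemidef.nonneg
  have hXA : ∀ p q, X p q = ∑ l, A l p * A l q := fun p q => by
    rw [hA]; simp [Matrix.mul_apply]
  let e := Fintype.equivFin (MTIndex k d)
  -- `c a` is a row of the Gram factor `A` restricted to the `v`-columns, so the trace constraint
  -- reads `∑ ‖c a‖² = 1`.
  let c : Fin (Fintype.card (MTIndex k d)) → EuclideanSpace ℝ (Fin d) :=
    fun a => WithLp.toLp 2 fun j => A (e.symm a) (MTIndex.v j)
  have hc : ∑ a, ‖c a‖ ^ 2 ≤ 1 := by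
    refine le_of_eq ?_
    rw [← hX.trace_v]
    simp only [hXA, EuclideanSpace.real_norm_sq_eq, c]
    rw [Finset.sum_comm]
    refine Finset.sum_congr rfl fun j _ => ?_
    rw [e.symm.sum_comp (fun l => A l (MTIndex.v j) ^ 2)]
    exact Finset.sum_congr rfl fun l _ => sq _
  refine (Finset.sum_le_sum fun i _ => ?_).trans
    (sum_min_le_truncSup r (⟨c, hc⟩ : UnitFamily _ _) fun i => Z i - x)
  set ξ := X (MTIndex.b i) (MTIndex.b i) with hξ
  set w := Z i - x with hw
  have hq : ∑ a, inner ℝ (c a) w ^ 2 = ∑ l, (∑ j, A l (MTIndex.v j) * w j) ^ 2 := by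
    rw [← e.symm.sum_comp]
    refine Finset.sum_congr rfl fun a _ => ?_
    simp [c, PiLp.inner_apply, mul_comm]
  have hξ0 : 0 ≤ ξ := hX.posSemidef.diag_nonneg
  have hξsum : ξ = ∑ l, A l (MTIndex.b i) ^ 2 := by
    rw [hξ, hXA]; exact Finset.sum_congr rfl fun l _ => (sq _).symm
  -- `ξ` is both the inner product of columns `1` and `b_i` of `A` and the squared norm of column
  -- `b_i`, while column `1` is a unit vector.
  have hcs1 : ξ ^ 2 ≤ 1 * ξ := by
    have h := Finset.sum_mul_sq_le_sq_mul_sq Finset.univ (fun l => A l MTIndex.one)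
      (fun l => A l (MTIndex.b i))
    rw [← hξsum, ← hXA, hX.one_b] at h
    have h1 : ∑ l, A l MTIndex.one ^ 2 = (1 : ℝ) := by
      rw [← hX.one_one, hXA]; exact Finset.sum_congr rfl fun l _ => sq _
    rwa [h1] at h
  -- `⟨v_{b_i}, w⟩` is the inner product of column `b_i` with the `w`-combination of the
  -- `v`-columns. With the margin constraint this gives `(ξ r)² ≤ ξ q`, from which one `ξ` cancels
  -- when positive.
  have hcs2 : inner ℝ (mtVec X i) w ^ 2 ≤ ξ * ∑ a, inner ℝ (c a) w ^ 2 := by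
    have h := Finset.sum_mul_sq_le_sq_mul_sq Finset.univ (fun l => A l (MTIndex.b i))
      (fun l => ∑ j, A l (MTIndex.v j) * w j)
    rw [← hξsum, ← hq] at h
    refine le_of_eq_of_le ?_ h
    congr 1
    simp only [mtVec, PiLp.inner_apply, hXA, Finset.mul_sum]
    rw [Finset.sum_comm]
    refine Finset.sum_congr rfl fun j _ => ?_
    simp only [RCLike.inner_apply, conj_trivial, Finset.mul_sum]
    exact Finset.sum_congr rfl fun l _ => by ring
  rcases hξ0.eq_or_lt with h0 | hpos
  · rw [← h0]
    exact (min_one_div_sq_mem_Icc r c w).1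
  refine le_min (by nlinarith) ?_
  rw [le_div_iff₀ (by positivity)]
  have h1 : (ξ * r) ^ 2 ≤ inner ℝ (mtVec X i) w ^ 2 :=
    pow_le_pow_left₀ (by positivity) (hX.margin i) 2
  refine le_of_mul_le_mul_left (?_ : ξ * (ξ * r ^ 2) ≤ ξ * _) hpos
  calc ξ * (ξ * r ^ 2) = (ξ * r) ^ 2 := by ring
    _ ≤ _ := h1.trans hcs2

/-! ### Trace and spectral norm as moments, and the conclusion. -/

theorem memLp_coord {Ω : Type*} [MeasurableSpace Ω] {P : Measure Ω} {d : ℕ}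
    {Y : Ω → EuclideanSpace ℝ (Fin d)} (hY : MemLp Y 2 P) (a : Fin d) : MemLp (fun ω => Y ω a) 2 P :=
  (EuclideanSpace.proj (𝕜 := ℝ) a).comp_memLp' hY

section Moments

variable {Ω : Type*} [MeasurableSpace Ω] {P : Measure Ω} [IsProbabilityMeasure P] {d : ℕ}
  {Y : Ω → EuclideanSpace ℝ (Fin d)} {μ : EuclideanSpace ℝ (Fin d)} {Λ : Matrix (Fin d) (Fin d) ℝ}

theorem integral_mul_sub_eq_cov (hY : MemLp Y 2 P) (hμ : ∫ ω, Y ω ∂P = μ)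
    (hΛ : ∀ a c, cov[fun ω => Y ω a, fun ω => Y ω c; P] = Λ a c) (a c : Fin d) :
    ∫ ω, (Y ω - μ) a * (Y ω - μ) c ∂P = Λ a c := by
  have hmean : ∀ a, ∫ ω, Y ω a ∂P = μ a := fun a => by
    rw [← hμ]
    exact (EuclideanSpace.proj (𝕜 := ℝ) a).integral_comp_comm (hY.integrable one_le_two)
  rw [← hΛ, covariance]
  simp [hmean]

theorem integral_norm_sq_sub_eq_trace (hY : MemLp Y 2 P) (hμ : ∫ ω, Y ω ∂P = μ)
    (hΛ : ∀ a c, cov[fun ω => Y ω a, fun ω => Y ω c; P] = Λ a c) :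
    ∫ ω, ‖Y ω - μ‖ ^ 2 ∂P = Λ.trace := by
  have hW : MemLp (fun ω => Y ω - μ) 2 P := hY.sub (memLp_const μ)
  simp only [EuclideanSpace.real_norm_sq_eq]
  rw [integral_finsetSum _ fun a _ => (memLp_coord hW a).integrable_sq]
  refine Finset.sum_congr rfl fun a _ => ?_
  simpa only [← sq, Matrix.diag_apply] using integral_mul_sub_eq_cov hY hμ hΛ a a

theorem integral_inner_sq_sub_le (hY : MemLp Y 2 P) (hμ : ∫ ω, Y ω ∂P = μ)
    (hΛ : ∀ a c, cov[fun ω => Y ω a, fun ω => Y ω c; P] = Λ a c) (v : EuclideanSpace ℝ (Fin d)) :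
    ∫ ω, inner ℝ v (Y ω - μ) ^ 2 ∂P ≤
      ‖Matrix.toEuclideanCLM (n := Fin d) (𝕜 := ℝ) Λ‖ * ‖v‖ ^ 2 := by
  have hW : MemLp (fun ω => Y ω - μ) 2 P := hY.sub (memLp_const μ)
  have hint : ∀ a c, Integrable (fun ω => v a * v c * ((Y ω - μ) a * (Y ω - μ) c)) P :=
    fun a c => ((memLp_coord hW a).integrable_mul (memLp_coord hW c)).const_mul _
  have hexp : ∀ ω, inner ℝ v (Y ω - μ) ^ 2 =
      ∑ a, ∑ c, v a * v c * ((Y ω - μ) a * (Y ω - μ) c) := fun ω => by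
    rw [PiLp.inner_apply, sq, Finset.sum_mul_sum]
    refine Finset.sum_congr rfl fun a _ => Finset.sum_congr rfl fun c _ => ?_
    simp only [RCLike.inner_apply, conj_trivial]
    ring
  -- The second moment in direction `v` is the quadratic form of `Λ` at `v`.
  have heq : ∫ ω, inner ℝ v (Y ω - μ) ^ 2 ∂P =
      inner ℝ v (Matrix.toEuclideanCLM (n := Fin d) (𝕜 := ℝ) Λ v) := by
    simp only [hexp]
    rw [integral_finsetSum _ fun a _ => integrable_finsetSum _ fun c _ => hint a c,
      Matrix.inner_toEuclideanCLM]
    refine Finset.sum_congr rfl fun a _ => ?_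
    rw [integral_finsetSum _ fun c _ => hint a c, Matrix.mulVec, dotProduct, Finset.mul_sum]
    refine Finset.sum_congr rfl fun c _ => ?_
    rw [integral_const_mul, integral_mul_sub_eq_cov hY hμ hΛ]
    ring
  rw [heq]
  refine (real_inner_le_norm _ _).trans ?_
  have := ContinuousLinearMap.le_opNorm (Matrix.toEuclideanCLM (n := Fin d) (𝕜 := ℝ) Λ) v
  nlinarith [norm_nonneg v]

end Moments

theorem mainTheorem3 {Ω : Type*} [MeasurableSpace Ω] (P : Measure Ω) [IsProbabilityMeasure P]
    (k d : ℕ) (Y : Fin k → Ω → EuclideanSpace ℝ (Fin d))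
    (μ : EuclideanSpace ℝ (Fin d)) (Λ : Matrix (Fin d) (Fin d) ℝ)
    (h_indep : iIndepFun Y P)
    (h_ident : ∀ i j, IdentDistrib (Y i) (Y j) P P)
    (h_memLp : ∀ i, MemLp (Y i) 2 P)
    (h_mean : ∀ i, ∫ ω, Y i ω ∂P = μ)
    (h_cov : ∀ i a c, cov[fun ω => Y i ω a, fun ω => Y i ω c; P] = Λ a c)
    (δ : ℝ) (hδ : 0 < δ)
    (hk : 3200 * Real.log (1 / δ) ≤ (k : ℝ))
    (r : ℝ) (hr_pos : 0 < r)
    (hr : 300 * (Real.sqrt (Λ.trace / k)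
      + Real.sqrt ‖Matrix.toEuclideanCLM (n := Fin d) (𝕜 := ℝ) Λ‖) ≤ r) :
    1 - δ ≤ P.real {ω | ∀ X : Matrix (MTIndex k d) (MTIndex k d) ℝ,
      MTFeasible μ r (fun i => Y i ω) X →
        ∑ i : Fin k, X (MTIndex.b i) (MTIndex.b i) ≤ (k : ℝ) / 20} := by
  have hexp : Real.exp (-(k / 3200)) ≤ δ := by
    rw [one_div, Real.log_inv] at hk
    rw [← Real.le_log_iff_exp_le hδ]
    linarith
  -- For `k = 0` the condition on `k` forces `δ ≥ 1`, and the bound is trivial.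
  rcases Nat.eq_zero_or_pos k with rfl | hkpos
  · have : 1 ≤ δ := by simpa using hexp
    exact (sub_nonpos.2 this).trans measureReal_nonneg
  let i₀ : Fin k := ⟨0, hkpos⟩
  have hsub : Measurable fun y : EuclideanSpace ℝ (Fin d) => y - μ := measurable_id.sub_const μ
  have hWm : ∀ i, AEMeasurable (fun ω => Y i ω - μ) P := fun i =>
    (h_memLp i).aestronglyMeasurable.aemeasurable.sub_const μ
  set ν := P.map (fun ω => Y i₀ ω - μ) with hν
  have : IsProbabilityMeasure ν := Measure.isProbabilityMeasure_map (hWm i₀)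
  have hlaw : P.map (fun ω i => Y i ω - μ) = Measure.pi fun _ : Fin k => ν := by
    have h := (iIndepFun_iff_map_fun_eq_pi_map hWm).1
      (h_indep.comp (fun _ y => y - μ) fun _ => hsub)
    rw [h]
    congr 1
    funext i
    exact ((h_ident i i₀).comp hsub).map_eq
  have hνL : MemLp (fun x : EuclideanSpace ℝ (Fin d) => x) 2 ν := by
    rw [hν, memLp_map_measure_iff (by fun_prop) (hWm i₀)]
    exact (h_memLp i₀).sub (memLp_const μ)
  have htr : ∫ x, ‖x‖ ^ 2 ∂ν = Λ.trace := by
    rw [hν, integral_map (hWm i₀) (by fun_prop)]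
    exact integral_norm_sq_sub_eq_trace (h_memLp i₀) (h_mean i₀) (h_cov i₀)
  have hop : ∀ v : EuclideanSpace ℝ (Fin d), ∫ x, inner ℝ v x ^ 2 ∂ν ≤
      ‖Matrix.toEuclideanCLM (n := Fin d) (𝕜 := ℝ) Λ‖ * ‖v‖ ^ 2 := fun v => by
    rw [hν, integral_map (hWm i₀) (by fun_prop)]
    exact integral_inner_sq_sub_le (h_memLp i₀) (h_mean i₀) (h_cov i₀) v
  have htail := measureReal_truncSup_ge_le ν (Fintype.card (MTIndex k d)) hkpos hνL
    (norm_nonneg _) hop hr_pos (by rw [htr]; exact hr)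
  set B : Set (Fin k → EuclideanSpace ℝ (Fin d)) :=
    {x | (k : ℝ) / 20 ≤ truncSup (Fintype.card (MTIndex k d)) r x} with hB
  have hBm : MeasurableSet B := measurableSet_le measurable_const (measurable_truncSup _ _)
  have hcompl : 1 - δ ≤ (Measure.pi fun _ : Fin k => ν).real Bᶜ := by
    rw [probReal_compl_eq_one_sub hBm]
    linarith
  rw [← hlaw, map_measureReal_apply_of_aemeasurable (aemeasurable_pi_lambda _ hWm)
    hBm.compl] at hcompl
  -- Monotonicity needs no measurability of the event quantified over all `X`; only `B` has to be
  -- measurable.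
  refine hcompl.trans (measureReal_mono fun ω hω X hX => ?_)
  have hω' : truncSup (Fintype.card (MTIndex k d)) r (fun i => Y i ω - μ) < k / 20 := by
    simpa [hB] using hω
  exact (hX.sum_le_truncSup hr_pos).trans hω'.le
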